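/- Call a map $F=(f_1,\dots,f_n):\mathbb{R}^n\to\mathbb{R}^n$ ($n>0$) everywhere defined rational if each $f_i$ is a quotient of two real polynomials whose denominator vanishes nowhere on $\mathbb{R}^n$, and nonsingular if it is differentiable with nowhere vanishing Jacobian determinant. A birational automorphism of $\mathbb{R}^n$ here means a bijection $A:\mathbb{R}^n\to\mathbb{R}^n$ such that $A$ and $A^{-1}$ are everywhere defined rational. Birational stable equivalence is the equivalence relation, on the set of all maps $\mathbb{R}^n\to\mathbb{R}^n$ in all dimensions $n>0$, generated by (1) $F\sim A\circ F\circ B$ for all birational automorphisms $A,B$ of $\mathbb{R}^n$, and (2) $F=(f_1,\dots,f_n)\sim(f_1,\dots,f_n,x_{n+1},\dots,x_m)$ for all $m>n$. For an everywhere defined rational nonsingular map $F:\mathbb{R}^n\to\mathbb{R}^n$, let $\mathbb{R}(X)$ be the field of rational functions in $X=(x_1,\dots,x_n)$, and let $\mathbb{R}(F)\subseteq\mathbb{R}(X)$ be the subfield generated over $\mathbb{R}$ by the components of $F$. Let $\mathrm{dex}(F)$ be the degree of the extension $\mathbb{R}(X)/\mathbb{R}(F)$, $\mathrm{sag}(F)$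 the number of field automorphisms of $\mathbb{R}(X)$ fixing $\mathbb{R}(F)$ elementwise, and $\mathrm{mfs}(F)=\sup_{y\in\mathbb{R}^n}\#F^{-1}(y)$ the maximum fiber size (all taken in $\mathbb{N}\cup\{\infty\}$). Theorem. Let $n,m>0$ and let $F:\mathbb{R}^n\to\mathbb{R}^n$ and $G:\mathbb{R}^m\to\mathbb{R}^m$ be birationally stably equivalent. Then $F$ is an everywhere defined rational nonsingular map if and only if $G$ is. If this is the case, then $\mathrm{dex}(F)=\mathrm{dex}(G)$, $\mathrm{sag}(F)=\mathrm{sag}(G)$ and $\mathrm{mfs}(F)=\mathrm{mfs}(G)$. -/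

import Mathlib

noncomputable section

namespace RealRational

/-- The field `ℝ(X)` of rational functions in `n` variables over `ℝ`. -/
abbrev RatField (n : ℕ) : Type := FractionRing (MvPolynomial (Fin n) ℝ)

/-- The function `f : ℝⁿ → ℝ` and the rational function `r ∈ ℝ(X)` are both given by one and the
same quotient of polynomials with nowhere vanishing denominator. -/
def Represents {n : ℕ} (r : RatField n) (f : (Fin n → ℝ) → ℝ) : Prop :=
  ∃ p q : MvPolynomial (Fin n) ℝ,
    (∀ x, MvPolynomial.eval x q ≠ 0) ∧
    (∀ x, f x = MvPolynomial.eval x p / MvPolynomial.eval x q) ∧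
    r = algebraMap (MvPolynomial (Fin n) ℝ) (RatField n) p /
      algebraMap (MvPolynomial (Fin n) ℝ) (RatField n) q

/-- `F` is an everywhere defined rational map: each component is a quotient of two polynomials
with nowhere vanishing denominator. -/
def IsEverywhereDefinedRational {n m : ℕ} (F : (Fin n → ℝ) → (Fin m → ℝ)) : Prop :=
  ∀ i, ∃ p q : MvPolynomial (Fin n) ℝ,
    (∀ x, MvPolynomial.eval x q ≠ 0) ∧
    (∀ x, F x i = MvPolynomial.eval x p / MvPolynomial.eval x q)

/-- `F` is differentiable and its Jacobian determinant vanishes nowhere. -/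
def IsNonsingular {n : ℕ} (F : (Fin n → ℝ) → (Fin n → ℝ)) : Prop :=
  Differentiable ℝ F ∧ ∀ x, (fderiv ℝ F x).det ≠ 0

/-- The subfield `ℝ(F)` of `ℝ(X)` generated over `ℝ` by the components of `F`.
(For an everywhere defined rational `F`, each component is represented by exactly one
element of `ℝ(X)`.) -/
def componentField {n : ℕ} (F : (Fin n → ℝ) → (Fin n → ℝ)) :
    IntermediateField ℝ (RatField n) :=
  IntermediateField.adjoin ℝ {r | ∃ i, Represents r (fun x => F x i)}

/-- The degree of the extension `ℝ(X)/ℝ(F)`. -/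
def dex {n : ℕ} (F : (Fin n → ℝ) → (Fin n → ℝ)) : ℕ∞ :=
  Cardinal.toENat (Module.rank (componentField F) (RatField n))

/-- The number of automorphisms of the extension `ℝ(X)/ℝ(F)`. -/
def sag {n : ℕ} (F : (Fin n → ℝ) → (Fin n → ℝ)) : ℕ∞ :=
  ENat.card (RatField n ≃ₐ[componentField F] RatField n)

/-- The maximum fiber size of `F`, as a supremum in `ℕ∞` (attained whenever it is finite). -/
def mfs {n : ℕ} (F : (Fin n → ℝ) → (Fin n → ℝ)) : ℕ∞ :=
  ⨆ y, (F ⁻¹' {y}).encard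

/-- The bijection `A` of `ℝⁿ` is an everywhere defined rational map, and so is its inverse. -/
def IsBirationalAutomorphism {n : ℕ} (A : (Fin n → ℝ) ≃ (Fin n → ℝ)) : Prop :=
  IsEverywhereDefinedRational (A : (Fin n → ℝ) → (Fin n → ℝ)) ∧
  IsEverywhereDefinedRational (A.symm : (Fin n → ℝ) → (Fin n → ℝ))

/-- The extension `(f₁, …, fₙ, xₙ₊₁, …, xₙ₊ₖ)` of `F = (f₁, …, fₙ)` by `k` fresh variables. -/
def extendFresh {n : ℕ} (k : ℕ) (F : (Fin n → ℝ) → (Fin n → ℝ)) :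
    (Fin (n + k) → ℝ) → (Fin (n + k) → ℝ) :=
  fun x => Fin.append (F (fun j => x (Fin.castAdd k j))) (fun j => x (Fin.natAdd n j))

/-- All self-maps of the spaces `ℝⁿ`, in all dimensions. -/
abbrev SelfMap : Type := Σ n : ℕ, ((Fin n → ℝ) → (Fin n → ℝ))

/-- The generating equivalences of birational stable equivalence, in positive dimensions:
coordinate changes in domain and codomain, and extension by fresh variables. -/
inductive BirationalStep : SelfMap → SelfMap → Prop
  | coordinates {n : ℕ} (hn : 0 < n) (F : (Fin n → ℝ) → (Fin n → ℝ))
      (A B : (Fin n → ℝ) ≃ (Fin n → ℝ))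
      (hA : IsBirationalAutomorphism A) (hB : IsBirationalAutomorphism B) :
      BirationalStep ⟨n, F⟩ ⟨n, A ∘ F ∘ B⟩
  | fresh {n : ℕ} (hn : 0 < n) (k : ℕ) (hk : 0 < k) (F : (Fin n → ℝ) → (Fin n → ℝ)) :
      BirationalStep ⟨n, F⟩ ⟨n + k, extendFresh k F⟩

/-- Birational stable equivalence: the equivalence relation generated by the steps above. -/
def BirationallyStablyEquivalent {n m : ℕ}
    (F : (Fin n → ℝ) → (Fin n → ℝ)) (G : (Fin m → ℝ) → (Fin m → ℝ)) : Prop :=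
  Relation.EqvGen BirationalStep ⟨n, F⟩ ⟨m, G⟩

end RealRational

end

/-! It suffices to treat one generating step, since sharing nonsingularity and all three invariants
is itself an equivalence relation on self-maps.

For `A ∘ F ∘ B`, composing with `A` on the left leaves `ℝ(F)` unchanged, because the components of
`A ∘ F` are rational expressions in those of `F` and conversely. Composing with `B` on the right is
substitution, an automorphism of `ℝ(X)` carrying `ℝ(F)` onto `ℝ(F ∘ B)` (`dex_sag_comp`).

For an extension by fresh variables, `ℝ(F) ⊆ ℝ(X)` becomes `ℝ(F)(T) ⊆ ℝ(X)(T)`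
(`mem_componentField_extendFresh_iff`). Nonsingularity enters here: by the Jacobian criterion
`ℝ(X)/ℝ(F)` is unramified, hence finite (`isAlgebraic_componentField`). For an algebraic extension
`L/K` the square formed with `K(T)` and `L(T)` is a pushout, so the degree is preserved.
Automorphisms correspond because `L` is algebraically closed in `L(T)` (`card_aut_eq_of_isPushout`).

Nonsingularity passes through both steps by the chain rule and a kernel computation, and fiber sizes
are compared directly. -/

noncomputable section

namespace RealRational

/-! ### Transport of degree and automorphism count along field isomorphisms -/

section Transfer

variable {K L K' L' : Type*} [Field K] [Field L] [Field K'] [Field L'] [Algebra K L] [Algebra K' L']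

/-- Field extensions matched by an isomorphism of the top fields have equally many
automorphisms. -/
theorem card_aut_eq_of_ringEquiv (e : L ≃+* L')
    (he : ∀ x, x ∈ (algebraMap K L).range ↔ e x ∈ (algebraMap K' L').range) :
    ENat.card (L ≃ₐ[K] L) = ENat.card (L' ≃ₐ[K'] L') := by
  have h1 : ∀ (σ : L ≃ₐ[K] L) (r : K'),
      e (σ (e.symm (algebraMap K' L' r))) = algebraMap K' L' r := by
    intro σ r
    obtain ⟨k, hk⟩ := (he (e.symm (algebraMap K' L' r))).2 (by simp)
    rw [← hk, AlgEquiv.commutes, hk, RingEquiv.apply_symm_apply]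
  have h2 : ∀ (τ : L' ≃ₐ[K'] L') (r : K),
      e.symm (τ (e (algebraMap K L r))) = algebraMap K L r := by
    intro τ r
    obtain ⟨k, hk⟩ := (he (algebraMap K L r)).1 (by simp)
    rw [← hk, AlgEquiv.commutes, hk, RingEquiv.symm_apply_apply]
  exact ENat.card_congr
    { toFun := fun σ => AlgEquiv.ofRingEquiv (f := (e.symm.trans σ.toRingEquiv).trans e) (h1 σ)
      invFun := fun τ => AlgEquiv.ofRingEquiv (f := (e.trans τ.toRingEquiv).trans e.symm) (h2 τ)
      left_inv := fun σ => by
        ext x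
        change e.symm (e (σ (e.symm (e x)))) = σ x
        simp
      right_inv := fun τ => by
        ext x
        change e (e.symm (τ (e (e.symm x)))) = τ x
        simp }

/-- Field extensions matched by an isomorphism of the top fields have the same degree. -/
theorem rank_toENat_eq_of_ringEquiv (e : L ≃+* L')
    (he : ∀ x, x ∈ (algebraMap K L).range ↔ e x ∈ (algebraMap K' L').range) :
    Cardinal.toENat (Module.rank K L) = Cardinal.toENat (Module.rank K' L') := by
  -- The map on base fields is read off from `e` by choosing preimages; injectivity of `algebraMap
  -- K' L'` makes it a ring homomorphism.
  let i : K → K' := fun k => ((he (algebraMap K L k)).1 (by simp)).choose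
  have hi : ∀ k, algebraMap K' L' (i k) = e (algebraMap K L k) := fun k =>
    ((he (algebraMap K L k)).1 (by simp)).choose_spec
  let f : K →+* K' :=
    { toFun := i
      map_one' := (algebraMap K' L').injective (by simp [hi])
      map_zero' := (algebraMap K' L').injective (by simp [hi])
      map_add' := fun a b => (algebraMap K' L').injective (by simp [hi])
      map_mul' := fun a b => (algebraMap K' L').injective (by simp [hi]) }
  have hf : Function.Bijective f := by
    refine ⟨f.injective, fun k' => ?_⟩
    obtain ⟨k, hk⟩ := (he (e.symm (algebraMap K' L' k'))).2 (by simp)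
    refine ⟨k, (algebraMap K' L').injective ?_⟩
    change algebraMap K' L' (i k) = _
    rw [hi, hk, RingEquiv.apply_symm_apply]
  have := Algebra.lift_rank_eq_of_equiv_equiv (RingEquiv.ofBijective f hf) e
    (RingHom.ext fun k => hi k)
  simpa using congrArg Cardinal.toENat this

end Transfer

/-! ### Base change to rational function fields -/

/-- Base change along a pushout of fields `K → K'`, `L → L'` with `L` relatively algebraically
closed in `L'` does not change the number of automorphisms of an algebraic extension. -/
theorem card_aut_eq_of_isPushout (K K' L L' : Type*) [Field K] [Field L] [Field K'] [Field L']
    [Algebra K L] [Algebra K K'] [Algebra L L'] [Algebra K' L'] [Algebra K L']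
    [IsScalarTower K K' L'] [IsScalarTower K L L'] [Algebra.IsPushout K K' L L']
    [Algebra.IsAlgebraic K L]
    (hclosed : ∀ z : L', IsAlgebraic L z → z ∈ (algebraMap L L').range) :
    ENat.card (L' ≃ₐ[K'] L') = ENat.card (L ≃ₐ[K] L) := by
  have : Algebra.IsAlgebraic K' L' := Algebra.IsPushout.isAlgebraic' K L K' L'
  let res : (L' →ₐ[K'] L') → (L →ₐ[K] L') := fun f =>
    (f.restrictScalars K).comp (IsScalarTower.toAlgHom K L L')
  -- The universal property of the pushout: a `K'`-homomorphism out of `L'` is the same as a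
  -- `K`-homomorphism out of `L`.
  have hres : Function.Bijective res := by
    constructor
    · intro f g hfg
      have h3 : f.restrictScalars K = g.restrictScalars K :=
        Algebra.IsPushout.algHom_ext (H := ‹Algebra.IsPushout K K' L L'›) L' hfg (by ext x; simp)
      ext z
      exact DFunLike.congr_fun h3 z
    · intro g
      let F := Algebra.pushoutDesc (R := K) (S := K') (R' := L) L'
        (IsScalarTower.toAlgHom K K' L') g (fun _ _ => mul_comm _ _)
      refine ⟨{ F with commutes' := fun r => ?_ }, ?_⟩
      · exact Algebra.pushoutDesc_left L' _ _ (fun _ _ => mul_comm _ _) r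
      · ext x
        exact Algebra.pushoutDesc_right L' _ _ (fun _ _ => mul_comm _ _) x
  let inc : (L →ₐ[K] L) → (L →ₐ[K] L') := fun f => (IsScalarTower.toAlgHom K L L').comp f
  -- A `K`-homomorphism sends algebraic elements to algebraic elements, so by `hclosed` its image
  -- lies in `L`.
  have hinc : Function.Bijective inc := by
    constructor
    · intro f g hfg
      ext x
      exact (algebraMap L L').injective (DFunLike.congr_fun hfg x)
    · intro g
      have hg : ∀ x, ∃ y, algebraMap L L' y = g x := fun x =>
        hclosed _ (((Algebra.IsAlgebraic.isAlgebraic (R := K) x).algHom g).tower_top L)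
      choose h hh using hg
      refine ⟨{ toFun := h, map_one' := ?_, map_mul' := ?_, map_zero' := ?_, map_add' := ?_,
                commutes' := ?_ }, ?_⟩
      · exact (algebraMap L L').injective (by simp [hh])
      · exact fun _ _ => (algebraMap L L').injective (by simp [hh])
      · exact (algebraMap L L').injective (by simp [hh])
      · exact fun _ _ => (algebraMap L L').injective (by simp [hh])
      · exact fun k => (algebraMap L L').injective
          (by rw [hh, AlgHom.commutes, ← IsScalarTower.algebraMap_apply])
      · ext x
        exact hh x
  -- Endomorphisms of an algebraic extension are automorphisms, so counting homomorphisms is enough.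
  exact ENat.card_congr <| (Algebra.IsAlgebraic.algEquivEquivAlgHom K' L').toEquiv.trans <|
    (Equiv.ofBijective res hres).trans <| (Equiv.ofBijective inc hinc).symm.trans
      (Algebra.IsAlgebraic.algEquivEquivAlgHom K L).toEquiv.symm

/-- A field is algebraically closed in its rational function fields. -/
theorem mem_range_of_isAlgebraic_mvRatFunc {σ L : Type*} [Field L]
    (z : FractionRing (MvPolynomial σ L)) (hz : IsAlgebraic L z) :
    z ∈ (algebraMap L (FractionRing (MvPolynomial σ L))).range := by
  by_cases h0 : z = 0
  · exact ⟨0, by simp [h0]⟩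
  -- The polynomial ring is integrally closed, so algebraic elements are polynomials. Applied to
  -- both `z` and `z⁻¹`, this makes `z` a unit polynomial, hence a constant.
  have key : ∀ w : FractionRing (MvPolynomial σ L), IsAlgebraic L w →
      ∃ p, algebraMap (MvPolynomial σ L) _ p = w := fun w hw =>
    IsIntegrallyClosed.isIntegral_iff.1 (hw.isIntegral.tower_top)
  obtain ⟨p, hp⟩ := key z hz
  obtain ⟨q, hq⟩ := key z⁻¹ hz.inv
  have hpq : p * q = 1 := by
    apply IsFractionRing.injective (MvPolynomial σ L) (FractionRing (MvPolynomial σ L))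
    rw [map_mul, hp, hq, map_one, mul_inv_cancel₀ h0]
  have hu : IsUnit p := IsUnit.of_mul_eq_one _ hpq
  obtain ⟨r, -, hr⟩ := MvPolynomial.isUnit_iff_eq_C_of_isReduced.1 hu
  refine ⟨r, ?_⟩
  rw [← hp, hr, IsScalarTower.algebraMap_apply L (MvPolynomial σ L), MvPolynomial.algebraMap_eq]

section MvRatFunc

variable (σ K L : Type*) [Field K] [Field L] [Algebra K L]

section
attribute [local instance] FractionRing.liftAlgebra MvPolynomial.algebraMvPolynomial

/-- The map of rational function fields induced by a field extension. -/
def mvRatFuncMap : FractionRing (MvPolynomial σ K) →+* FractionRing (MvPolynomial σ L) :=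
  algebraMap _ _

@[simp]
theorem mvRatFuncMap_algebraMap (a : K) :
    mvRatFuncMap σ K L (algebraMap K _ a) = algebraMap L _ (algebraMap K L a) := by
  unfold mvRatFuncMap
  rw [← IsScalarTower.algebraMap_apply, ← IsScalarTower.algebraMap_apply]

@[simp]
theorem mvRatFuncMap_X (i : σ) :
    mvRatFuncMap σ K L (algebraMap (MvPolynomial σ K) _ (MvPolynomial.X i)) =
      algebraMap (MvPolynomial σ L) _ (MvPolynomial.X i) := by
  unfold mvRatFuncMap
  rw [← IsScalarTower.algebraMap_apply,
    IsScalarTower.algebraMap_apply (MvPolynomial σ K) (MvPolynomial σ L)]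
  exact congrArg _ (MvPolynomial.map_X _ _)

variable {σ K L} {K' L' : Type*} [Field K'] [Field L'] [Algebra K' L'] [Algebra.IsAlgebraic K L]

/-- Adjoining variables to both fields of an algebraic extension preserves the degree. -/
theorem rank_toENat_eq_of_mvRatFunc (e : L' ≃+* FractionRing (MvPolynomial σ L))
    (he : ∀ x, x ∈ (algebraMap K' L').range ↔ e x ∈ (mvRatFuncMap σ K L).range) :
    Cardinal.toENat (Module.rank K L) = Cardinal.toENat (Module.rank K' L') := by
  refine Eq.trans ?_ (rank_toENat_eq_of_ringEquiv e he).symm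
  have h := (Algebra.isPushout_iff K (FractionRing (MvPolynomial σ K)) L
    (FractionRing (MvPolynomial σ L))).mp inferInstance |>.lift_rank_eq
  simpa using (congrArg Cardinal.toENat h).symm

/-- Adjoining variables to both fields of an algebraic extension preserves the number of
automorphisms. -/
theorem card_aut_eq_of_mvRatFunc (e : L' ≃+* FractionRing (MvPolynomial σ L))
    (he : ∀ x, x ∈ (algebraMap K' L').range ↔ e x ∈ (mvRatFuncMap σ K L).range) :
    ENat.card (L ≃ₐ[K] L) = ENat.card (L' ≃ₐ[K'] L') := by
  refine Eq.trans ?_ (card_aut_eq_of_ringEquiv (K' := FractionRing (MvPolynomial σ K)) e he).symm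
  exact (card_aut_eq_of_isPushout K (FractionRing (MvPolynomial σ K)) L
    (FractionRing (MvPolynomial σ L)) mem_range_of_isAlgebraic_mvRatFunc).symm

end

end MvRatFunc

/-! ### Rational functions, the real functions they represent, and substitution -/

open MvPolynomial

theorem algebraMap_ne_zero_of_eval_ne_zero {n : ℕ} {q : MvPolynomial (Fin n) ℝ} {x : Fin n → ℝ}
    (hq : eval x q ≠ 0) : algebraMap _ (RatField n) q ≠ 0 := by
  intro h
  have : q = 0 := IsFractionRing.injective (MvPolynomial (Fin n) ℝ) (RatField n) (by simpa using h)
  simp [this] at hq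

/-- Cross-multiplying gives polynomials that agree at every real point, and such polynomials are
equal. Identities in `ℝ(X)` can therefore be checked on functions. -/
theorem Represents.unique {n : ℕ} {r s : RatField n} {f : (Fin n → ℝ) → ℝ}
    (hr : Represents r f) (hs : Represents s f) : r = s := by
  obtain ⟨p, q, hq, hf, rfl⟩ := hr
  obtain ⟨p', q', hq', hf', rfl⟩ := hs
  rw [div_eq_div_iff (algebraMap_ne_zero_of_eval_ne_zero (hq 0))
    (algebraMap_ne_zero_of_eval_ne_zero (hq' 0)), ← map_mul, ← map_mul]
  congr 1
  apply MvPolynomial.funext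
  intro x
  have := (hf x).symm.trans (hf' x)
  rw [div_eq_div_iff (hq x) (hq' x)] at this
  simpa using this

theorem represents_algebraMap {n : ℕ} (p : MvPolynomial (Fin n) ℝ) :
    Represents (algebraMap _ (RatField n) p) (fun x => eval x p) :=
  ⟨p, 1, by simp, by simp, by simp⟩

theorem Represents.add {n : ℕ} {r s : RatField n} {f g : (Fin n → ℝ) → ℝ}
    (hr : Represents r f) (hs : Represents s g) : Represents (r + s) (fun x => f x + g x) := by
  obtain ⟨p, q, hq, hf, rfl⟩ := hr
  obtain ⟨p', q', hq', hg, rfl⟩ := hs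
  refine ⟨p * q' + q * p', q * q', fun x => by simp [hq, hq'], fun x => ?_, ?_⟩
  · simp [hf, hg, div_add_div _ _ (hq x) (hq' x)]
  · simp [div_add_div _ _ (algebraMap_ne_zero_of_eval_ne_zero (hq 0))
      (algebraMap_ne_zero_of_eval_ne_zero (hq' 0))]

theorem Represents.mul {n : ℕ} {r s : RatField n} {f g : (Fin n → ℝ) → ℝ}
    (hr : Represents r f) (hs : Represents s g) : Represents (r * s) (fun x => f x * g x) := by
  obtain ⟨p, q, hq, hf, rfl⟩ := hr
  obtain ⟨p', q', hq', hg, rfl⟩ := hs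
  exact ⟨p * p', q * q', fun x => by simp [hq, hq'],
    fun x => by simp [hf, hg, div_mul_div_comm], by simp [div_mul_div_comm]⟩

theorem Represents.inv {n : ℕ} {r : RatField n} {f : (Fin n → ℝ) → ℝ}
    (hr : Represents r f) (h0 : ∀ x, f x ≠ 0) : Represents r⁻¹ (fun x => (f x)⁻¹) := by
  obtain ⟨p, q, hq, hf, rfl⟩ := hr
  refine ⟨q, p, fun x hx => h0 x (by simp [hf, hx]), fun x => by simp [hf], by simp⟩

theorem Represents.div {n : ℕ} {r s : RatField n} {f g : (Fin n → ℝ) → ℝ}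
    (hr : Represents r f) (hs : Represents s g) (h0 : ∀ x, g x ≠ 0) :
    Represents (r / s) (fun x => f x / g x) := by
  simpa only [div_eq_mul_inv] using hr.mul (hs.inv h0)

/-- Representatives of the components of a map, one for each component. -/
def RepresentsMap {n m : ℕ} (r : Fin m → RatField n) (F : (Fin n → ℝ) → (Fin m → ℝ)) : Prop :=
  ∀ i, Represents (r i) (fun x => F x i)

theorem isEverywhereDefinedRational_iff {n m : ℕ} {F : (Fin n → ℝ) → (Fin m → ℝ)} :
    IsEverywhereDefinedRational F ↔ ∃ r, RepresentsMap r F := by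
  constructor
  · intro h
    choose p q hq hF using h
    exact ⟨fun i => algebraMap _ _ (p i) / algebraMap _ _ (q i),
      fun i => ⟨p i, q i, hq i, hF i, rfl⟩⟩
  · rintro ⟨r, hr⟩ i
    obtain ⟨p, q, hq, hF, -⟩ := hr i
    exact ⟨p, q, hq, hF⟩

theorem representsMap_X (n : ℕ) :
    RepresentsMap (fun i => algebraMap (MvPolynomial (Fin n) ℝ) (RatField n) (X i)) (fun x : Fin n → ℝ => x) := fun i => by
  simpa using represents_algebraMap (X i)

theorem RepresentsMap.aeval {n m : ℕ} {r : Fin m → RatField n} {F : (Fin n → ℝ) → (Fin m → ℝ)}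
    (h : RepresentsMap r F) (p : MvPolynomial (Fin m) ℝ) :
    Represents (MvPolynomial.aeval r p) (fun x => eval (F x) p) := by
  induction p using MvPolynomial.induction_on with
  | C a =>
    have := represents_algebraMap (C a : MvPolynomial (Fin n) ℝ)
    rw [aeval_C, IsScalarTower.algebraMap_apply ℝ (MvPolynomial (Fin n) ℝ), algebraMap_eq]
    simpa only [eval_C] using this
  | add p q hp hq => simpa using hp.add hq
  | mul_X p i hp => simpa using hp.mul (h i)

theorem RepresentsMap.comp {n m : ℕ} {r : Fin m → RatField n} {B : (Fin n → ℝ) → (Fin m → ℝ)}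
    (h : RepresentsMap r B) {p q : MvPolynomial (Fin m) ℝ} (hq : ∀ x, eval x q ≠ 0) :
    Represents (MvPolynomial.aeval r p / MvPolynomial.aeval r q)
      (fun x => eval (B x) p / eval (B x) q) :=
  (h.aeval p).div (h.aeval q) fun x => hq (B x)

theorem IsEverywhereDefinedRational.comp {n m k : ℕ} {F : (Fin m → ℝ) → (Fin k → ℝ)}
    {B : (Fin n → ℝ) → (Fin m → ℝ)} (hF : IsEverywhereDefinedRational F)
    (hB : IsEverywhereDefinedRational B) : IsEverywhereDefinedRational (F ∘ B) := by
  obtain ⟨r, hr⟩ := isEverywhereDefinedRational_iff.1 hB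
  intro i
  obtain ⟨p, q, hq, hF⟩ := hF i
  obtain ⟨p', q', hq', hF', -⟩ := hr.comp (p := p) hq
  exact ⟨p', q', hq', fun x => by simpa [hF] using hF' x⟩

/-- A polynomial killed by the substitution vanishes on the image of `B`, which is all of `ℝᵐ`. This
is what lets substitution extend to fractions. -/
theorem RepresentsMap.aeval_injective {n m : ℕ} {r : Fin m → RatField n}
    {B : (Fin n → ℝ) → (Fin m → ℝ)} (h : RepresentsMap r B) (hB : Function.Surjective B) :
    Function.Injective (MvPolynomial.aeval r : MvPolynomial (Fin m) ℝ →ₐ[ℝ] RatField n) := by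
  rw [injective_iff_map_eq_zero]
  intro p hp
  have h1 := h.aeval p
  rw [hp] at h1
  obtain ⟨p', q, hq, hf, h0⟩ := h1
  have hp' : p' = 0 := by
    rw [eq_comm, div_eq_zero_iff,
      or_iff_left (algebraMap_ne_zero_of_eval_ne_zero (hq 0))] at h0
    exact IsFractionRing.injective (MvPolynomial (Fin n) ℝ) (RatField n) (by simpa using h0)
  apply MvPolynomial.funext
  intro y
  obtain ⟨x, rfl⟩ := hB y
  simp [hf, hp']

/-- The substitution `ℝ(X₁, …, Xₘ) → ℝ(X₁, …, Xₙ)`, `Xᵢ ↦ rᵢ`, for representatives `rᵢ` of the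
components of a surjective map. -/
def RepresentsMap.subst {n m : ℕ} {r : Fin m → RatField n} {B : (Fin n → ℝ) → (Fin m → ℝ)}
    (h : RepresentsMap r B) (hB : Function.Surjective B) : RatField m →ₐ[ℝ] RatField n :=
  IsFractionRing.liftAlgHom (h.aeval_injective hB)

@[simp]
theorem RepresentsMap.subst_algebraMap {n m : ℕ} {r : Fin m → RatField n}
    {B : (Fin n → ℝ) → (Fin m → ℝ)} (h : RepresentsMap r B) (hB : Function.Surjective B)
    (p : MvPolynomial (Fin m) ℝ) :
    h.subst hB (algebraMap _ _ p) = MvPolynomial.aeval r p := by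
  simp [RepresentsMap.subst]

theorem RepresentsMap.represents_subst {n m : ℕ} {r : Fin m → RatField n}
    {B : (Fin n → ℝ) → (Fin m → ℝ)} (h : RepresentsMap r B) (hB : Function.Surjective B)
    {s : RatField m} {f : (Fin m → ℝ) → ℝ} (hs : Represents s f) :
    Represents (h.subst hB s) (fun x => f (B x)) := by
  obtain ⟨p, q, hq, hf, rfl⟩ := hs
  simpa [hf] using h.comp (p := p) hq

theorem ratField_algHom_ext {n : ℕ} {E : Type*} [Field E] [Algebra ℝ E] {f g : RatField n →ₐ[ℝ] E}
    (h : ∀ i, f (algebraMap (MvPolynomial (Fin n) ℝ) _ (X i)) =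
      g (algebraMap (MvPolynomial (Fin n) ℝ) _ (X i))) : f = g := by
  apply IsLocalization.algHom_ext (nonZeroDivisors (MvPolynomial (Fin n) ℝ))
  apply MvPolynomial.algHom_ext
  exact h

/-- Both sides are determined by the variables, where uniqueness of representatives reduces the
claim to `A (B x) = x`. -/
theorem RepresentsMap.subst_comp_subst {n : ℕ} {r s : Fin n → RatField n}
    {A B : (Fin n → ℝ) → (Fin n → ℝ)} (hr : RepresentsMap r A) (hs : RepresentsMap s B)
    (hA : Function.Surjective A) (hB : Function.Surjective B) (hAB : ∀ x, A (B x) = x) :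
    (hs.subst hB).comp (hr.subst hA) = AlgHom.id ℝ (RatField n) := by
  apply ratField_algHom_ext
  intro i
  have h1 : Represents (hs.subst hB (hr.subst hA (algebraMap (MvPolynomial (Fin n) ℝ) _ (X i)))) (fun x => x i) := by
    have := hs.represents_subst hB (hr.represents_subst hA (representsMap_X n i))
    simpa only [hAB] using this
  exact h1.unique (representsMap_X n i)

/-- Substitution of a birational automorphism, as an automorphism of `ℝ(X)`. -/
theorem exists_substEquiv {n : ℕ} {B : (Fin n → ℝ) ≃ (Fin n → ℝ)}
    (hB : IsBirationalAutomorphism B) :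
    ∃ e : RatField n ≃ₐ[ℝ] RatField n,
      ∀ s f, Represents s f → Represents (e s) (fun x => f (B x)) := by
  obtain ⟨r, hr⟩ := isEverywhereDefinedRational_iff.1 hB.1
  obtain ⟨s, hs⟩ := isEverywhereDefinedRational_iff.1 hB.2
  refine ⟨AlgEquiv.ofAlgHom (hr.subst B.surjective) (hs.subst B.symm.surjective)
    (hs.subst_comp_subst hr _ _ (by simp)) (hr.subst_comp_subst hs _ _ (by simp)), ?_⟩
  intro t f ht
  exact hr.represents_subst B.surjective ht

/-! ### The field of components under coordinate changes -/

theorem RepresentsMap.componentField_eq {n : ℕ} {r : Fin n → RatField n}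
    {F : (Fin n → ℝ) → (Fin n → ℝ)} (h : RepresentsMap r F) :
    componentField F = IntermediateField.adjoin ℝ (Set.range r) := by
  unfold componentField
  congr 1
  ext s
  constructor
  · rintro ⟨i, hi⟩
    exact ⟨i, (h i).unique hi⟩
  · rintro ⟨i, rfl⟩
    exact ⟨i, h i⟩

theorem componentField_comp_left_le {n : ℕ} {A F : (Fin n → ℝ) → (Fin n → ℝ)}
    (hA : IsEverywhereDefinedRational A) (hF : IsEverywhereDefinedRational F) :
    componentField (A ∘ F) ≤ componentField F := by
  obtain ⟨r, hr⟩ := isEverywhereDefinedRational_iff.1 hF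
  rw [hr.componentField_eq]
  refine IntermediateField.adjoin_le_iff.2 ?_
  rintro s ⟨i, hs⟩
  obtain ⟨p, q, hq, hA⟩ := hA i
  have h1 := hr.comp (p := p) hq
  rw [hs.unique (by simpa [hA] using h1)]
  have hmem : ∀ p, MvPolynomial.aeval r p ∈ IntermediateField.adjoin ℝ (Set.range r) := fun p =>
    IntermediateField.algebra_adjoin_le_adjoin ℝ _ (by
      rw [Algebra.adjoin_range_eq_range_aeval]; exact ⟨p, rfl⟩)
  exact div_mem (hmem p) (hmem q)

theorem componentField_comp_left {n : ℕ} {A : (Fin n → ℝ) ≃ (Fin n → ℝ)}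
    {F : (Fin n → ℝ) → (Fin n → ℝ)} (hA : IsBirationalAutomorphism A)
    (hF : IsEverywhereDefinedRational F) :
    componentField (A ∘ F) = componentField F := by
  refine le_antisymm (componentField_comp_left_le hA.1 hF) ?_
  -- The reverse inclusion comes from writing `F` as `A.symm ∘ (A ∘ F)`.
  have := componentField_comp_left_le hA.2 (hA.1.comp hF)
  rwa [← Function.comp_assoc, Equiv.symm_comp_self, Function.id_comp] at this

theorem exists_ringEquiv_componentField_comp_right {n : ℕ} {B : (Fin n → ℝ) ≃ (Fin n → ℝ)}
    {F : (Fin n → ℝ) → (Fin n → ℝ)} (hB : IsBirationalAutomorphism B)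
    (hF : IsEverywhereDefinedRational F) :
    ∃ e : RatField n ≃+* RatField n,
      ∀ s, s ∈ componentField F ↔ e s ∈ componentField (F ∘ B) := by
  obtain ⟨e, he⟩ := exists_substEquiv hB
  obtain ⟨r, hr⟩ := isEverywhereDefinedRational_iff.1 hF
  have hr' : RepresentsMap (fun i => e (r i)) (F ∘ B) := fun i => he _ _ (hr i)
  refine ⟨e.toRingEquiv, fun s => ?_⟩
  have h1 : componentField (F ∘ B) = (componentField F).map (e : RatField n →ₐ[ℝ] RatField n) := by
    rw [hr'.componentField_eq, hr.componentField_eq, IntermediateField.adjoin_map, ← Set.range_comp]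
    rfl
  rw [h1, IntermediateField.mem_map]
  constructor
  · intro hs
    exact ⟨s, hs, rfl⟩
  · rintro ⟨t, ht, hts⟩
    rwa [← e.injective hts]

theorem mem_range_algebraMap_componentField {n : ℕ} {F : (Fin n → ℝ) → (Fin n → ℝ)}
    {s : RatField n} :
    s ∈ (algebraMap (componentField F) (RatField n)).range ↔ s ∈ componentField F :=
  ⟨fun ⟨t, ht⟩ => ht ▸ t.2, fun h => ⟨⟨s, h⟩, rfl⟩⟩

theorem dex_sag_comp {n : ℕ} {A B : (Fin n → ℝ) ≃ (Fin n → ℝ)}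
    {F : (Fin n → ℝ) → (Fin n → ℝ)} (hA : IsBirationalAutomorphism A)
    (hB : IsBirationalAutomorphism B) (hF : IsEverywhereDefinedRational F) :
    dex F = dex (A ∘ F ∘ B) ∧ sag F = sag (A ∘ F ∘ B) := by
  obtain ⟨e, he⟩ := exists_ringEquiv_componentField_comp_right hB hF
  rw [← componentField_comp_left hA (hF.comp hB.1)] at he
  have h1 : ∀ s, s ∈ (algebraMap (componentField F) (RatField n)).range ↔
      e s ∈ (algebraMap (componentField (A ∘ F ∘ B)) (RatField n)).range := fun s => by
    rw [mem_range_algebraMap_componentField, mem_range_algebraMap_componentField, he]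
  exact ⟨rank_toENat_eq_of_ringEquiv e h1, card_aut_eq_of_ringEquiv e h1⟩

/-! ### The Jacobian criterion -/

theorem hasFDerivAt_eval {n : ℕ} (p : MvPolynomial (Fin n) ℝ) (x : Fin n → ℝ) :
    HasFDerivAt (fun x => eval x p)
      (∑ j, eval x (pderiv j p) • (ContinuousLinearMap.proj j : (Fin n → ℝ) →L[ℝ] ℝ)) x := by
  induction p using MvPolynomial.induction_on with
  | C a => simpa using hasFDerivAt_const a x
  | add p q hp hq =>
    simp only [map_add, add_smul, Finset.sum_add_distrib]
    exact hp.add hq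
  | mul_X p i hp =>
    have hi : HasFDerivAt (fun x : Fin n → ℝ => x i)
      (ContinuousLinearMap.proj i : (Fin n → ℝ) →L[ℝ] ℝ) x := hasFDerivAt_apply i x
    simp only [eval_mul, eval_X]
    refine (hp.mul hi).congr_fderiv ?_
    simp only [Derivation.leibniz, pderiv_X, smul_eq_mul, map_add, map_mul, add_smul,
      Finset.sum_add_distrib, Finset.smul_sum, smul_smul, eval_X]
    congr 1
    rw [Finset.sum_eq_single i]
    · simp
    · intro j _ hj
      simp [hj.symm]
    · simp

theorem IsEverywhereDefinedRational.differentiable {n m : ℕ} {F : (Fin n → ℝ) → (Fin m → ℝ)}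
    (hF : IsEverywhereDefinedRational F) : Differentiable ℝ F := by
  rw [differentiable_pi]
  intro i
  obtain ⟨p, q, hq, hF⟩ := hF i
  simp only [hF]
  intro x
  have hp' := (hasFDerivAt_eval p x).differentiableAt
  have hq' := (hasFDerivAt_eval q x).differentiableAt
  simp only [div_eq_mul_inv]
  exact hp'.fun_mul (hq'.fun_inv (hq x))

/-- The algebraic chain rule: a derivation over `ℝ` is determined on polynomials by its values on
the variables. -/
theorem derivation_algebraMap {n : ℕ} {M : Type*} [AddCommGroup M] [Module (RatField n) M]
    [Module ℝ M] (D : Derivation ℝ (RatField n) M) (p : MvPolynomial (Fin n) ℝ) :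
    D (algebraMap _ _ p) = ∑ j, algebraMap (MvPolynomial (Fin n) ℝ) (RatField n) (pderiv j p) •
      D (algebraMap (MvPolynomial (Fin n) ℝ) _ (X j)) := by
  induction p using MvPolynomial.induction_on with
  | C a =>
    rw [← algebraMap_eq, ← IsScalarTower.algebraMap_apply, D.map_algebraMap, algebraMap_eq]
    simp
  | add p q hp hq => simp [hp, hq, add_smul, Finset.sum_add_distrib]
  | mul_X p i hp =>
    simp only [map_mul, Derivation.leibniz, hp, pderiv_X, smul_eq_mul, map_add, add_smul,
      Finset.sum_add_distrib, Finset.smul_sum, smul_smul]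
    congr 1
    rw [Finset.sum_eq_single i]
    · simp
    · intro j _ hj
      simp [hj.symm]
    · simp

/-- A square linear system in a vector space with nonvanishing determinant has only the trivial
solution. -/
theorem eq_zero_of_sum_smul_eq_zero {n : ℕ} {L M : Type*} [Field L] [AddCommGroup M] [Module L M]
    (A : Matrix (Fin n) (Fin n) L) (hA : A.det ≠ 0) (v : Fin n → M)
    (h : ∀ i, ∑ j, A i j • v j = 0) (k : Fin n) : v k = 0 := by
  have h1 : ∑ i, A⁻¹ k i • ∑ j, A i j • v j = 0 := by simp [h]
  simp only [Finset.smul_sum, smul_smul] at h1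
  rw [Finset.sum_comm] at h1
  simp only [← Finset.sum_smul, ← Matrix.mul_apply] at h1
  rw [Matrix.nonsing_inv_mul _ (isUnit_iff_ne_zero.2 hA)] at h1
  simpa [Matrix.one_apply] using h1

/-- Numerators of the Jacobian matrix of the rational map with components `pᵢ / qᵢ`. -/
def jacobianNumerator {n : ℕ} (p q : Fin n → MvPolynomial (Fin n) ℝ) :
    Matrix (Fin n) (Fin n) (MvPolynomial (Fin n) ℝ) :=
  fun i j => q i * pderiv j (p i) - p i * pderiv j (q i)

theorem det_jacobianNumerator_ne_zero {n : ℕ} {p q : Fin n → MvPolynomial (Fin n) ℝ}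
    {F : (Fin n → ℝ) → (Fin n → ℝ)} (hq : ∀ i x, eval x (q i) ≠ 0)
    (hF : ∀ i x, F x i = eval x (p i) / eval x (q i)) (hns : IsNonsingular F) :
    (jacobianNumerator p q).det ≠ 0 := by
  intro h0
  have h1 : ((eval (0 : Fin n → ℝ)).mapMatrix (jacobianNumerator p q)).det = 0 := by
    rw [← RingHom.map_det, h0, map_zero]
  obtain ⟨v, hv0, hv⟩ := Matrix.exists_mulVec_eq_zero_iff.2 h1
  apply hv0
  -- Differentiating `F i * q i = p i` at the origin shows that row `i` of the numerator matrix
  -- there is `(q i)²` times row `i` of the derivative of `F`. A kernel vector of the former is thus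
  -- one of the latter.
  have h2 : fderiv ℝ F 0 v = 0 := by
    ext i
    have hd : HasFDerivAt (fun x => F x i)
        ((ContinuousLinearMap.proj i : (Fin n → ℝ) →L[ℝ] ℝ).comp (fderiv ℝ F 0)) 0 :=
      hasFDerivAt_pi'.1 (hns.1 0).hasFDerivAt i
    have hm := hd.mul (hasFDerivAt_eval (q i) 0)
    have he : ((fun x => F x i) * fun x => eval x (q i)) = fun x => eval x (p i) := by
      ext x
      change F x i * _ = _
      rw [hF, div_mul_cancel₀ _ (hq i x)]
    have hu := congrArg (fun f => f v) ((he ▸ hm :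
      HasFDerivAt (fun x => eval x (p i)) _ 0).unique (hasFDerivAt_eval (p i) 0))
    have hvi := congrFun hv i
    simp only [Matrix.mulVec, dotProduct, RingHom.mapMatrix_apply, Matrix.map_apply,
      jacobianNumerator, map_sub, map_mul, sub_mul, Finset.sum_sub_distrib, mul_assoc,
      ← Finset.mul_sum, Pi.zero_apply] at hvi
    simp only [_root_.add_apply, _root_.smul_apply,
      ContinuousLinearMap.comp_apply, ContinuousLinearMap.proj_apply, smul_eq_mul,
      _root_.sum_apply] at hu
    rw [← hu, hF] at hvi
    have := hq i 0
    field_simp at hvi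
    have h3 : eval 0 (q i) * eval 0 (q i) * fderiv ℝ F 0 v i = 0 := by linarith
    exact (mul_eq_zero.1 h3).resolve_left (mul_ne_zero this this)
  have h3 : LinearMap.det (fderiv ℝ F 0 : (Fin n → ℝ) →ₗ[ℝ] (Fin n → ℝ)) ≠ 0 := hns.2 0
  by_contra hv'
  exact h3 (LinearMap.det_eq_zero_iff_ker_ne_bot.2 fun hb =>
    hv' (LinearMap.ker_eq_bot'.1 hb v h2))

/-- The Jacobian criterion: over the field of components of a nonsingular everywhere defined
rational map, the field of rational functions is unramified. -/
theorem formallyUnramified_componentField {n : ℕ} {F : (Fin n → ℝ) → (Fin n → ℝ)}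
    (hF : IsEverywhereDefinedRational F) (hns : IsNonsingular F) :
    Algebra.FormallyUnramified (componentField F) (RatField n) := by
  choose p q hq hF using hF
  let K := componentField F
  let D := KaehlerDifferential.D K (RatField n)
  let D' : Derivation ℝ (RatField n) (Ω[RatField n⁄K]) := D.restrictScalars ℝ
  -- Each `p i / q i` lies in the base field, so its differential is zero. Clearing denominators
  -- yields a linear system for the differentials of the variables, with the invertible numerator
  -- matrix as coefficients.
  have hX : ∀ j, D' (algebraMap (MvPolynomial (Fin n) ℝ) _ (X j)) = 0 := by
    refine eq_zero_of_sum_smul_eq_zero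
      ((algebraMap _ (RatField n)).mapMatrix (jacobianNumerator p q)) ?_ _ fun i => ?_
    · rw [← RingHom.map_det]
      exact fun h => det_jacobianNumerator_ne_zero hq hF hns
        (IsFractionRing.injective (MvPolynomial (Fin n) ℝ) (RatField n) (by simpa using h))
    · have hmem : algebraMap _ (RatField n) (p i) / algebraMap _ (RatField n) (q i) ∈ K :=
        IntermediateField.subset_adjoin _ _ ⟨i, p i, q i, hq i, hF i, rfl⟩
      have h0 : D' (algebraMap _ (RatField n) (p i) / algebraMap _ (RatField n) (q i)) = 0 :=
        D.map_algebraMap (⟨_, hmem⟩ : K)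
      have hq0 := algebraMap_ne_zero_of_eval_ne_zero (hq i 0)
      have h1 : D' (algebraMap _ (RatField n) (p i)) =
          (algebraMap _ (RatField n) (p i) / algebraMap _ (RatField n) (q i)) •
            D' (algebraMap _ (RatField n) (q i)) := by
        conv_lhs => rw [← div_mul_cancel₀ (algebraMap _ (RatField n) (p i)) hq0]
        rw [Derivation.leibniz, h0, smul_zero, add_zero]
      have h2 : algebraMap _ (RatField n) (q i) • D' (algebraMap _ (RatField n) (p i)) -
          algebraMap _ (RatField n) (p i) • D' (algebraMap _ (RatField n) (q i)) = 0 := by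
        rw [h1, smul_smul, mul_div_cancel₀ _ hq0, sub_self]
      rw [derivation_algebraMap, derivation_algebraMap, Finset.smul_sum, Finset.smul_sum,
        ← Finset.sum_sub_distrib] at h2
      simpa only [jacobianNumerator, RingHom.mapMatrix_apply, Matrix.map_apply, map_sub, map_mul,
        sub_smul, smul_smul] using h2
  have hD : ∀ s, D s = 0 := by
    intro s
    obtain ⟨a, b, hb, rfl⟩ := IsFractionRing.div_surjective (A := MvPolynomial (Fin n) ℝ) s
    have hpoly : ∀ a : MvPolynomial (Fin n) ℝ, D' (algebraMap _ _ a) = 0 := fun a => by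
      rw [derivation_algebraMap]
      simp [hX]
    change D' _ = 0
    rw [Derivation.leibniz_div, hpoly, hpoly]
    simp
  constructor
  have hspan := KaehlerDifferential.span_range_derivation K (RatField n)
  have : Set.range (KaehlerDifferential.D K (RatField n)) ⊆ {0} := by
    rintro _ ⟨s, rfl⟩
    exact hD s
  have hle := Submodule.span_mono (R := RatField n) this
  rw [hspan, Submodule.span_singleton_eq_bot.2 rfl] at hle
  exact (Submodule.subsingleton_iff (RatField n)).1 (subsingleton_of_bot_eq_top (le_bot_iff.1 hle).symm)

/-- An unramified field extension that is essentially of finite type is finite; `ℝ(X)` is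
essentially of finite type already over `ℝ`. -/
theorem isAlgebraic_componentField {n : ℕ} {F : (Fin n → ℝ) → (Fin n → ℝ)}
    (hF : IsEverywhereDefinedRational F) (hns : IsNonsingular F) :
    Algebra.IsAlgebraic (componentField F) (RatField n) := by
  have := formallyUnramified_componentField hF hns
  have : Algebra.EssFiniteType (componentField F) (RatField n) :=
    Algebra.EssFiniteType.of_comp ℝ (componentField F) (RatField n)
  have := Algebra.FormallyUnramified.finite_of_free (componentField F) (RatField n)
  infer_instance

/-! ### Adjoining fresh variables -/

/-- The field of rational functions in `n + k` variables, as the rational functions in `k`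
variables over the rational functions in `n` variables. -/
def splitHom (n k : ℕ) :
    MvPolynomial (Fin (n + k)) ℝ →ₐ[ℝ] FractionRing (MvPolynomial (Fin k) (RatField n)) :=
  (IsScalarTower.toAlgHom ℝ (MvPolynomial (Fin k) (RatField n)) _).comp <|
  (MvPolynomial.mapAlgHom (IsScalarTower.toAlgHom ℝ (MvPolynomial (Fin n) ℝ) (RatField n))).comp <|
  ((MvPolynomial.sumAlgEquiv ℝ (Fin k) (Fin n)).toAlgHom).comp <|
  (MvPolynomial.renameEquiv ℝ (finSumFinEquiv.symm.trans (Equiv.sumComm (Fin n) (Fin k)))).toAlgHom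

theorem splitHom_injective (n k : ℕ) : Function.Injective (splitHom n k) := by
  unfold splitHom
  simp only [AlgHom.coe_comp]
  refine (IsFractionRing.injective _ _).comp (Function.Injective.comp ?_
    (Function.Injective.comp (AlgEquiv.injective _) (AlgEquiv.injective _)))
  exact MvPolynomial.map_injective _ (IsFractionRing.injective _ _)

theorem splitHom_X_castAdd (n k : ℕ) (i : Fin n) :
    splitHom n k (X (Fin.castAdd k i)) =
      algebraMap (RatField n) _ (algebraMap (MvPolynomial (Fin n) ℝ) _ (X i)) := by
  rw [IsScalarTower.algebraMap_apply (RatField n) (MvPolynomial (Fin k) (RatField n))]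
  simp [splitHom, MvPolynomial.algebraMap_eq]

theorem splitHom_X_natAdd (n k : ℕ) (j : Fin k) :
    splitHom n k (X (Fin.natAdd n j)) =
      algebraMap (MvPolynomial (Fin k) (RatField n)) _ (X j) := by
  simp [splitHom]

/-- Generation of a rational function field by constants and variables, phrased so that it applies
to ranges and preimages of field homomorphisms. -/
theorem mvRatFunc_mem_of_mem {σ L : Type*} [Field L] {S : Subfield (FractionRing (MvPolynomial σ L))}
    (hC : ∀ a : L, algebraMap L _ a ∈ S) (hX : ∀ i, algebraMap (MvPolynomial σ L) _ (X i) ∈ S)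
    (z : FractionRing (MvPolynomial σ L)) : z ∈ S := by
  have hp : ∀ p : MvPolynomial σ L, algebraMap _ _ p ∈ S := by
    intro p
    induction p using MvPolynomial.induction_on with
    | C a =>
      rw [← MvPolynomial.algebraMap_eq, ← IsScalarTower.algebraMap_apply]
      exact hC a
    | add p q hp hq => rw [map_add]; exact add_mem hp hq
    | mul_X p i hp => rw [map_mul]; exact mul_mem hp (hX i)
  obtain ⟨a, b, hb, rfl⟩ := IsFractionRing.div_surjective (A := MvPolynomial σ L) z
  exact div_mem (hp a) (hp b)

/-- `ℝ(X₁, …, Xₙ₊ₖ) → ℝ(X₁, …, Xₙ)(Xₙ₊₁, …, Xₙ₊ₖ)`. -/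
def splitFieldHom (n k : ℕ) :
    RatField (n + k) →ₐ[ℝ] FractionRing (MvPolynomial (Fin k) (RatField n)) :=
  IsFractionRing.liftAlgHom (splitHom_injective n k)

theorem splitFieldHom_algebraMap (n k : ℕ) (p : MvPolynomial (Fin (n + k)) ℝ) :
    splitFieldHom n k (algebraMap _ _ p) = splitHom n k p := by
  simp [splitFieldHom]

theorem splitFieldHom_bijective (n k : ℕ) : Function.Bijective (splitFieldHom n k) := by
  refine ⟨(splitFieldHom n k).toRingHom.injective, fun z => ?_⟩
  have key : z ∈ (splitFieldHom n k).toRingHom.fieldRange := by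
    refine mvRatFunc_mem_of_mem (fun a => ?_) (fun j => ?_) z
    · have : a ∈ (splitFieldHom n k).toRingHom.fieldRange.comap
          (algebraMap (RatField n) (FractionRing (MvPolynomial (Fin k) (RatField n)))) := by
        refine mvRatFunc_mem_of_mem (fun c => ?_) (fun i => ?_) a
        · refine ⟨algebraMap ℝ _ c, ?_⟩
          rw [← IsScalarTower.algebraMap_apply]
          exact (splitFieldHom n k).commutes c
        · refine ⟨algebraMap (MvPolynomial (Fin (n + k)) ℝ) _ (X (Fin.castAdd k i)), ?_⟩
          exact (splitFieldHom_algebraMap n k _).trans (splitHom_X_castAdd n k i)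
      exact this
    · exact ⟨algebraMap (MvPolynomial (Fin (n + k)) ℝ) _ (X (Fin.natAdd n j)),
        (splitFieldHom_algebraMap n k _).trans (splitHom_X_natAdd n k j)⟩
  exact key

/-- `ℝ(X₁, …, Xₙ₊ₖ) ≃ ℝ(X₁, …, Xₙ)(Xₙ₊₁, …, Xₙ₊ₖ)`. -/
def splitEquiv (n k : ℕ) :
    RatField (n + k) ≃ₐ[ℝ] FractionRing (MvPolynomial (Fin k) (RatField n)) :=
  AlgEquiv.ofBijective (splitFieldHom n k) (splitFieldHom_bijective n k)

theorem splitEquiv_X_castAdd (n k : ℕ) (i : Fin n) :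
    splitEquiv n k (algebraMap (MvPolynomial (Fin (n + k)) ℝ) _ (X (Fin.castAdd k i))) =
      algebraMap (RatField n) _ (algebraMap (MvPolynomial (Fin n) ℝ) _ (X i)) :=
  (splitFieldHom_algebraMap n k _).trans (splitHom_X_castAdd n k i)

theorem splitEquiv_X_natAdd (n k : ℕ) (j : Fin k) :
    splitEquiv n k (algebraMap (MvPolynomial (Fin (n + k)) ℝ) _ (X (Fin.natAdd n j))) =
      algebraMap (MvPolynomial (Fin k) (RatField n)) _ (X j) :=
  (splitFieldHom_algebraMap n k _).trans (splitHom_X_natAdd n k j)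

theorem representsMap_castAdd (n k : ℕ) :
    RepresentsMap (fun j => algebraMap (MvPolynomial (Fin (n + k)) ℝ) (RatField (n + k))
      (X (Fin.castAdd k j))) (fun (x : Fin (n + k) → ℝ) j => x (Fin.castAdd k j)) :=
  fun j => representsMap_X (n + k) (Fin.castAdd k j)

theorem castAdd_surjective (n k : ℕ) :
    Function.Surjective (fun (x : Fin (n + k) → ℝ) (j : Fin n) => x (Fin.castAdd k j)) :=
  fun y => ⟨Fin.append y 0, by ext j; simp⟩

theorem splitEquiv_subst {n k : ℕ} (s : RatField n) :
    splitEquiv n k ((representsMap_castAdd n k).subst (castAdd_surjective n k) s) =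
      algebraMap (RatField n) _ s := by
  have : ((splitEquiv n k).toAlgHom.comp
      ((representsMap_castAdd n k).subst (castAdd_surjective n k))) =
      IsScalarTower.toAlgHom ℝ (RatField n) (FractionRing (MvPolynomial (Fin k) (RatField n))) := by
    apply ratField_algHom_ext
    intro i
    simpa using splitEquiv_X_castAdd n k i
  exact DFunLike.congr_fun this s

theorem RepresentsMap.extendFresh {n : ℕ} (k : ℕ) {r : Fin n → RatField n}
    {F : (Fin n → ℝ) → (Fin n → ℝ)} (hr : RepresentsMap r F) :
    RepresentsMap (Fin.append
      (fun i => (representsMap_castAdd n k).subst (castAdd_surjective n k) (r i))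
      (fun j => algebraMap (MvPolynomial (Fin (n + k)) ℝ) _ (X (Fin.natAdd n j))))
      (extendFresh k F) := by
  intro i
  refine Fin.addCases (fun i => ?_) (fun j => ?_) i
  · simpa [RealRational.extendFresh] using
      (representsMap_castAdd n k).represents_subst (castAdd_surjective n k) (hr i)
  · simpa [RealRational.extendFresh] using representsMap_X (n + k) (Fin.natAdd n j)

/-- Both fields are generated by the components of `F` together with the fresh variables; each
inclusion is checked on generators. -/
theorem mem_componentField_extendFresh_iff {n : ℕ} (k : ℕ) {F : (Fin n → ℝ) → (Fin n → ℝ)}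
    (hF : IsEverywhereDefinedRational F) (s : RatField (n + k)) :
    s ∈ componentField (extendFresh k F) ↔ splitEquiv n k s ∈
      (mvRatFuncMap (Fin k) (componentField F) (RatField n)).range := by
  obtain ⟨r, hr⟩ := isEverywhereDefinedRational_iff.1 hF
  constructor
  · let T : IntermediateField ℝ (RatField (n + k)) :=
      { (mvRatFuncMap (Fin k) (componentField F) (RatField n)).fieldRange.comap
            (splitEquiv n k).toAlgHom.toRingHom with
        algebraMap_mem' := fun c => by
          refine ⟨algebraMap (componentField F) _ (algebraMap ℝ _ c), ?_⟩
          rw [mvRatFuncMap_algebraMap, ← IsScalarTower.algebraMap_apply,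
            ← IsScalarTower.algebraMap_apply]
          exact ((splitEquiv n k).commutes c).symm }
    suffices h : componentField (extendFresh k F) ≤ T from fun hs => h hs
    rw [(hr.extendFresh k).componentField_eq]
    refine IntermediateField.adjoin_le_iff.2 ?_
    rintro _ ⟨i, rfl⟩
    refine Fin.addCases (fun i => ?_) (fun j => ?_) i
    · have hmem : r i ∈ componentField F := IntermediateField.subset_adjoin _ _ ⟨i, hr i⟩
      refine ⟨algebraMap (componentField F) _ ⟨r i, hmem⟩, ?_⟩
      rw [Fin.append_left, mvRatFuncMap_algebraMap]
      exact (splitEquiv_subst (r i)).symm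
    · refine ⟨algebraMap (MvPolynomial (Fin k) (componentField F)) _ (X j), ?_⟩
      rw [Fin.append_right, mvRatFuncMap_X]
      exact (splitEquiv_X_natAdd n k j).symm
  · rintro ⟨z, hz⟩
    rw [← (splitEquiv n k).symm_apply_apply s, ← hz]
    have : z ∈ (componentField (extendFresh k F)).toSubfield.comap
        ((splitEquiv n k).symm.toAlgHom.toRingHom.comp
          (mvRatFuncMap (Fin k) (componentField F) (RatField n))) := by
      refine mvRatFunc_mem_of_mem (fun a => ?_) (fun j => ?_) z
      · have ha : ∀ a ∈ componentField F,
            (representsMap_castAdd n k).subst (castAdd_surjective n k) a ∈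
              componentField (extendFresh k F) := by
          rw [hr.componentField_eq, (hr.extendFresh k).componentField_eq]
          intro a ha
          have h1 : (representsMap_castAdd n k).subst (castAdd_surjective n k) a ∈
              (IntermediateField.adjoin ℝ (Set.range r)).map
                ((representsMap_castAdd n k).subst (castAdd_surjective n k)) := ⟨a, ha, rfl⟩
          rw [IntermediateField.adjoin_map, ← Set.range_comp] at h1
          refine IntermediateField.adjoin.mono _ _ _ ?_ h1
          rintro _ ⟨i, rfl⟩
          exact ⟨Fin.castAdd k i, by simp⟩
        have h2 := ha a a.2
        rw [← (splitEquiv n k).symm_apply_apply (RepresentsMap.subst _ _ (a : RatField n)),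
          splitEquiv_subst] at h2
        change (splitEquiv n k).symm (mvRatFuncMap (Fin k) (componentField F) (RatField n)
          (algebraMap (componentField F) _ a)) ∈ componentField (extendFresh k F)
        rw [mvRatFuncMap_algebraMap]
        exact h2
      · have h2 : algebraMap (MvPolynomial (Fin (n + k)) ℝ) _ (X (Fin.natAdd n j)) ∈
            componentField (extendFresh k F) :=
          IntermediateField.subset_adjoin _ _ ⟨Fin.natAdd n j, by
            simpa using hr.extendFresh k (Fin.natAdd n j)⟩
        rw [← (splitEquiv n k).symm_apply_apply (algebraMap _ _ _), splitEquiv_X_natAdd] at h2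
        change (splitEquiv n k).symm (mvRatFuncMap (Fin k) (componentField F) (RatField n)
          (algebraMap (MvPolynomial (Fin k) (componentField F)) _ (X j))) ∈ componentField (extendFresh k F)
        rw [mvRatFuncMap_X]
        exact h2
    exact this

theorem dex_sag_extendFresh {n : ℕ} (k : ℕ) {F : (Fin n → ℝ) → (Fin n → ℝ)}
    (hF : IsEverywhereDefinedRational F)
    [Algebra.IsAlgebraic (componentField F) (RatField n)] :
    dex F = dex (extendFresh k F) ∧ sag F = sag (extendFresh k F) := by
  have h1 : ∀ s, s ∈ (algebraMap (componentField (extendFresh k F)) (RatField (n + k))).range ↔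
      (splitEquiv n k).toRingEquiv s ∈
        (mvRatFuncMap (Fin k) (componentField F) (RatField n)).range := fun s => by
    rw [mem_range_algebraMap_componentField, mem_componentField_extendFresh_iff k hF]
    rfl
  exact ⟨rank_toENat_eq_of_mvRatFunc _ h1, card_aut_eq_of_mvRatFunc _ h1⟩

/-! ### Nonsingularity and fibers under the generating steps -/

/-- Working with kernels avoids block determinants below. -/
theorem det_ne_zero_iff {n : ℕ} (f : (Fin n → ℝ) →L[ℝ] (Fin n → ℝ)) :
    f.det ≠ 0 ↔ ∀ v, f v = 0 → v = 0 := by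
  have h := (LinearMap.det_eq_zero_iff_ker_ne_bot (f := (f : (Fin n → ℝ) →ₗ[ℝ] (Fin n → ℝ)))).not
  rw [not_not, LinearMap.ker_eq_bot'] at h
  exact h

theorem IsNonsingular.comp {n : ℕ} {F G : (Fin n → ℝ) → (Fin n → ℝ)} (hF : IsNonsingular F)
    (hG : IsNonsingular G) : IsNonsingular (F ∘ G) := by
  refine ⟨hF.1.comp hG.1, fun x => (det_ne_zero_iff _).2 fun v hv => ?_⟩
  rw [fderiv_comp x (hF.1 _) (hG.1 x)] at hv
  exact (det_ne_zero_iff _).1 (hG.2 x) v ((det_ne_zero_iff _).1 (hF.2 (G x)) _ hv)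

theorem IsBirationalAutomorphism.symm {n : ℕ} {A : (Fin n → ℝ) ≃ (Fin n → ℝ)}
    (hA : IsBirationalAutomorphism A) : IsBirationalAutomorphism A.symm :=
  ⟨hA.2, hA.1⟩

theorem IsBirationalAutomorphism.isNonsingular {n : ℕ} {A : (Fin n → ℝ) ≃ (Fin n → ℝ)}
    (hA : IsBirationalAutomorphism A) : IsNonsingular A := by
  refine ⟨hA.1.differentiable, fun x => (det_ne_zero_iff _).2 fun v hv => ?_⟩
  -- The chain rule for `A.symm ∘ A = id` gives the derivative of `A` a left inverse.
  have h := fderiv_comp x (hA.2.differentiable (A x)) (hA.1.differentiable x)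
  rw [Equiv.symm_comp_self, fderiv_id] at h
  have := DFunLike.congr_fun h v
  simpa [hv] using this

theorem nonsingularRational_comp {n : ℕ} {F : (Fin n → ℝ) → (Fin n → ℝ)}
    {A B : (Fin n → ℝ) ≃ (Fin n → ℝ)} (hA : IsBirationalAutomorphism A)
    (hB : IsBirationalAutomorphism B) (hF : IsEverywhereDefinedRational F ∧ IsNonsingular F) :
    IsEverywhereDefinedRational (A ∘ F ∘ B) ∧ IsNonsingular (A ∘ F ∘ B) :=
  ⟨hA.1.comp (hF.1.comp hB.1), hA.isNonsingular.comp (hF.2.comp hB.isNonsingular)⟩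

theorem nonsingularRational_comp_iff {n : ℕ} {F : (Fin n → ℝ) → (Fin n → ℝ)}
    {A B : (Fin n → ℝ) ≃ (Fin n → ℝ)} (hA : IsBirationalAutomorphism A)
    (hB : IsBirationalAutomorphism B) :
    (IsEverywhereDefinedRational F ∧ IsNonsingular F) ↔
      (IsEverywhereDefinedRational (A ∘ F ∘ B) ∧ IsNonsingular (A ∘ F ∘ B)) := by
  refine ⟨nonsingularRational_comp hA hB, fun h => ?_⟩
  have h' := nonsingularRational_comp hA.symm hB.symm h
  have he : A.symm ∘ (A ∘ F ∘ B) ∘ B.symm = F := by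
    ext x
    simp
  rwa [he] at h'

theorem mfs_comp {n : ℕ} (F : (Fin n → ℝ) → (Fin n → ℝ)) (A B : (Fin n → ℝ) ≃ (Fin n → ℝ)) :
    mfs F = mfs (A ∘ F ∘ B) := by
  unfold mfs
  refine Equiv.iSup_congr A fun y => ?_
  have : (A ∘ F ∘ B) ⁻¹' {A y} = B.symm '' (F ⁻¹' {y}) := by
    ext x
    simp [Equiv.image_symm_eq_preimage]
  rw [this, B.symm.injective.encard_image]

/-- The zero section, along which `F` is recovered from its extension. -/
theorem isEverywhereDefinedRational_append_zero (n k : ℕ) :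
    IsEverywhereDefinedRational (fun x : Fin n → ℝ => (Fin.append x 0 : Fin (n + k) → ℝ)) := by
  intro i
  refine Fin.addCases (fun i => ?_) (fun j => ?_) i
  · exact ⟨X i, 1, by simp, by simp⟩
  · exact ⟨0, 1, by simp, by simp⟩

theorem isEverywhereDefinedRational_extendFresh_iff {n : ℕ} (k : ℕ)
    {F : (Fin n → ℝ) → (Fin n → ℝ)} :
    IsEverywhereDefinedRational F ↔ IsEverywhereDefinedRational (extendFresh k F) := by
  constructor
  · intro h
    obtain ⟨r, hr⟩ := isEverywhereDefinedRational_iff.1 h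
    exact isEverywhereDefinedRational_iff.2 ⟨_, hr.extendFresh k⟩
  · intro h i
    obtain ⟨p, q, hq, hE⟩ :=
      h.comp (isEverywhereDefinedRational_append_zero n k) (Fin.castAdd k i)
    exact ⟨p, q, hq, fun x => by simpa [extendFresh] using hE x⟩

theorem fderiv_extendFresh_castAdd {n k : ℕ} {F : (Fin n → ℝ) → (Fin n → ℝ)}
    (hF : Differentiable ℝ F) (hE : Differentiable ℝ (extendFresh k F)) (x v : Fin (n + k) → ℝ)
    (i : Fin n) :
    fderiv ℝ (extendFresh k F) x v (Fin.castAdd k i) =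
      fderiv ℝ F (fun j => x (Fin.castAdd k j)) (fun j => v (Fin.castAdd k j)) i := by
  let π : (Fin (n + k) → ℝ) →L[ℝ] (Fin n → ℝ) :=
    ContinuousLinearMap.pi fun j => ContinuousLinearMap.proj (Fin.castAdd k j)
  have h1 := hasFDerivAt_pi'.1 (hE x).hasFDerivAt (Fin.castAdd k i)
  have h2 := hasFDerivAt_pi'.1 ((hF (π x)).hasFDerivAt.comp x π.hasFDerivAt) i
  have he : (fun x => extendFresh k F x (Fin.castAdd k i)) = fun x => (F ∘ π) x i := by
    ext x
    simp only [extendFresh, Fin.append_left]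
    rfl
  rw [he] at h1
  exact DFunLike.congr_fun (h1.unique h2) v

theorem fderiv_extendFresh_natAdd {n k : ℕ} {F : (Fin n → ℝ) → (Fin n → ℝ)}
    (hE : Differentiable ℝ (extendFresh k F)) (x v : Fin (n + k) → ℝ) (j : Fin k) :
    fderiv ℝ (extendFresh k F) x v (Fin.natAdd n j) = v (Fin.natAdd n j) := by
  have h1 := hasFDerivAt_pi'.1 (hE x).hasFDerivAt (Fin.natAdd n j)
  have he : (fun x => extendFresh k F x (Fin.natAdd n j)) = fun x => x (Fin.natAdd n j) := by
    ext x
    simp [extendFresh]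
  rw [he] at h1
  exact DFunLike.congr_fun (h1.unique (hasFDerivAt_apply (Fin.natAdd n j) x)) v

/-- The derivative of the extension is block diagonal with blocks the derivative of `F` and the
identity, so its kernel vectors are those of `F` padded by zeros. -/
theorem nonsingularRational_extendFresh_iff {n : ℕ} (k : ℕ) {F : (Fin n → ℝ) → (Fin n → ℝ)} :
    (IsEverywhereDefinedRational F ∧ IsNonsingular F) ↔
      (IsEverywhereDefinedRational (extendFresh k F) ∧ IsNonsingular (extendFresh k F)) := by
  rw [← isEverywhereDefinedRational_extendFresh_iff]
  refine and_congr_right fun hF => ?_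
  have hdF := hF.differentiable
  have hdE := ((isEverywhereDefinedRational_extendFresh_iff k).1 hF).differentiable
  constructor
  · refine fun h => ⟨hdE, fun x => (det_ne_zero_iff _).2 fun v hv => ?_⟩
    have h1 : (fun j => v (Fin.castAdd k j)) = 0 := by
      refine (det_ne_zero_iff _).1 (h.2 fun j => x (Fin.castAdd k j)) _ ?_
      ext i
      rw [← fderiv_extendFresh_castAdd hdF hdE, hv]
      rfl
    ext i
    refine Fin.addCases (fun i => ?_) (fun j => ?_) i
    · exact congrFun h1 i
    · rw [← fderiv_extendFresh_natAdd hdE x v, hv]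
  · refine fun h => ⟨hdF, fun x => (det_ne_zero_iff _).2 fun v hv => ?_⟩
    have h1 : (Fin.append v 0 : Fin (n + k) → ℝ) = 0 := by
      refine (det_ne_zero_iff _).1 (h.2 (Fin.append x 0)) _ ?_
      ext i
      refine Fin.addCases (fun i => ?_) (fun j => ?_) i
      · rw [fderiv_extendFresh_castAdd hdF hdE]
        simp [hv]
      · rw [fderiv_extendFresh_natAdd hdE]
        simp
    ext i
    simpa using congrFun h1 (Fin.castAdd k i)

/-- The fresh coordinates are constant on each fiber of the extension, so dropping them embeds it in
a fiber of `F`; padding by zeros gives the other bound. -/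
theorem mfs_extendFresh {n : ℕ} (k : ℕ) (F : (Fin n → ℝ) → (Fin n → ℝ)) :
    mfs F = mfs (extendFresh k F) := by
  refine le_antisymm (iSup_le fun y => ?_) (iSup_le fun w => ?_)
  · refine le_trans ?_ (le_iSup _ (Fin.append y 0))
    refine Set.encard_le_encard_of_injOn (f := fun x => Fin.append x 0) ?_ ?_
    · intro x hx
      have hx : F x = y := hx
      simp only [extendFresh, Set.mem_preimage, Set.mem_singleton_iff, Fin.append_left,
        Fin.append_right, hx]
    · intro x _ x' _ hxx
      ext i
      simpa using congrFun hxx (Fin.castAdd k i)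
  · refine le_trans ?_ (le_iSup _ fun j => w (Fin.castAdd k j))
    refine Set.encard_le_encard_of_injOn (f := fun x j => x (Fin.castAdd k j)) ?_ ?_
    · intro x hx
      have hx : extendFresh k F x = w := hx
      ext j
      simp [← hx, extendFresh]
    · intro x hx x' hx' hxx
      have hx : extendFresh k F x = w := hx
      have hx' : extendFresh k F x' = w := hx'
      ext i
      refine Fin.addCases (fun i => ?_) (fun j => ?_) i
      · exact congrFun hxx i
      · simpa [extendFresh] using congrFun (hx.trans hx'.symm) (Fin.natAdd n j)

/-! ### Passing from generating steps to the equivalence relation -/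

/-- The relation between self-maps asserting that being nonsingular rational is shared, and that
in this case the numerical invariants agree. -/
def SameInvariants (S T : SelfMap) : Prop :=
  ((IsEverywhereDefinedRational S.2 ∧ IsNonsingular S.2) ↔
    (IsEverywhereDefinedRational T.2 ∧ IsNonsingular T.2)) ∧
  ((IsEverywhereDefinedRational S.2 ∧ IsNonsingular S.2) →
    dex S.2 = dex T.2 ∧ sag S.2 = sag T.2 ∧ mfs S.2 = mfs T.2)

theorem BirationalStep.sameInvariants {S T : SelfMap} (h : BirationalStep S T) :
    SameInvariants S T := by
  cases h with
  | coordinates hn F A B hA hB =>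
    refine ⟨nonsingularRational_comp_iff hA hB, fun h => ?_⟩
    obtain ⟨h1, h2⟩ := dex_sag_comp hA hB h.1
    exact ⟨h1, h2, mfs_comp F A B⟩
  | fresh hn k hk F =>
    refine ⟨nonsingularRational_extendFresh_iff k, fun h => ?_⟩
    have := isAlgebraic_componentField h.1 h.2
    obtain ⟨h1, h2⟩ := dex_sag_extendFresh k h.1
    exact ⟨h1, h2, mfs_extendFresh k F⟩

theorem SameInvariants.of_eqvGen {S T : SelfMap} (h : Relation.EqvGen BirationalStep S T) :
    SameInvariants S T := by
  induction h with
  | rel S T h => exact h.sameInvariants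
  | refl S => exact ⟨Iff.rfl, fun _ => ⟨rfl, rfl, rfl⟩⟩
  | symm S T _ ih =>
    refine ⟨ih.1.symm, fun h => ?_⟩
    obtain ⟨h1, h2, h3⟩ := ih.2 (ih.1.2 h)
    exact ⟨h1.symm, h2.symm, h3.symm⟩
  | trans S T U _ _ ih ih' =>
    refine ⟨ih.1.trans ih'.1, fun h => ?_⟩
    obtain ⟨h1, h2, h3⟩ := ih.2 h
    obtain ⟨h1', h2', h3'⟩ := ih'.2 (ih.1.1 h)
    exact ⟨h1.trans h1', h2.trans h2', h3.trans h3'⟩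

end RealRational

end

theorem mainTheorem3 {n m : ℕ} (hn : 0 < n) (hm : 0 < m)
    (F : (Fin n → ℝ) → (Fin n → ℝ)) (G : (Fin m → ℝ) → (Fin m → ℝ))
    (hFG : RealRational.BirationallyStablyEquivalent F G) :
    ((RealRational.IsEverywhereDefinedRational F ∧ RealRational.IsNonsingular F) ↔
      (RealRational.IsEverywhereDefinedRational G ∧ RealRational.IsNonsingular G)) ∧
    ((RealRational.IsEverywhereDefinedRational F ∧ RealRational.IsNonsingular F) →
      RealRational.dex F = RealRational.dex G ∧
      RealRational.sag F = RealRational.sag G ∧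
      RealRational.mfs F = RealRational.mfs G) := by
  exact RealRational.SameInvariants.of_eqvGen hFG
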